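/- A Hadamard space is a complete $\mathrm{CAT}(0)$ geodesic metric space. Let $(X,d)$ be a Hadamard space, $A\subset X$ a nonempty finite set, and $x\in X\setminus A$. For points $y,z\ne x$ let $\angle zxy\in[0,\pi]$ denote the Alexandrov angle at $x$ between the geodesic segments $[x,z]$ and $[x,y]$. The mean deficit of $A$ at $x$ is $$\operatorname{def}_A(x)=\max\Big\{\,0,\ \sup_{y\in X,\,y\neq x}\ \min_{a\in A}\ d(a,x)\cos\angle axy\Big\}.$$ The tangent cone $T_xX$ is the set of pairs $([\gamma],r)$, where $r\ge 0$ and $[\gamma]$ is the class of a nontrivial geodesic $\gamma$ with origin $x$ (two geodesics being identified when the angle between them at $x$ is zero), with all pairs $([\gamma],0)$ identified to a single point, the apex; its metric is given by $$d\big(([\gamma],r),([\gamma'],r')\big)^2=r^2+r'^2-2rr'\cos\angle(\gamma,\gamma'),$$ and the length of $([\gamma],r)$ is $r$, its distance from the apex. Theorem (Tangent criterion). Suppose that $T_xX$ is isometric to a (finite-dimensional) Euclidean space, and hence carries the notion of convex combination transported through any isometry (this does not depend on the isometry, because isometries between Euclidean spaces are affine). Then among the convex combinations in $T_xX$ of the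 vectors $\big([[x,a]],d(x,a)\big)$, $a\in A$, there is a shortest one, and its length is $\operatorname{def}_A(x)$. -/

import Mathlib

open Filter Topology

/-! ### Hadamard spaces -/

/-- `γ`, restricted to `[0, d(x,y)]`, is a geodesic (an isometric embedding of the interval) from `x`
to `y`.  The values of `γ` outside this interval are irrelevant. -/
structure IsGeodesic {X : Type*} [MetricSpace X] (x y : X) (γ : ℝ → X) : Prop where
  left : γ 0 = x
  right : γ (dist x y) = y
  dist_eq : ∀ s ∈ Set.Icc 0 (dist x y), ∀ t ∈ Set.Icc 0 (dist x y), dist (γ s) (γ t) = |s - t|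

/-- A Hadamard space: a complete geodesic metric space satisfying the `CAT(0)` inequality. -/
class HadamardSpace (X : Type*) [MetricSpace X] : Prop extends CompleteSpace X where
  exists_geodesic : ∀ x y : X, ∃ γ : ℝ → X, IsGeodesic x y γ
  cat_zero : ∀ (x y : X) (γ : ℝ → X), IsGeodesic x y γ → ∀ z : X, ∀ t ∈ Set.Icc (0 : ℝ) 1,
    dist z (γ (t * dist x y)) ^ 2 ≤
      (1 - t) * dist z x ^ 2 + t * dist z y ^ 2 - t * (1 - t) * dist x y ^ 2

/-- The geodesic segment `[x,y]` (unique in a Hadamard space), parametrized by arc length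
from `x`. -/
noncomputable def geodesicSegment {X : Type*} [MetricSpace X] [HadamardSpace X] (x y : X) : ℝ → X :=
  (HadamardSpace.exists_geodesic x y).choose

theorem geodesicSegment_isGeodesic {X : Type*} [MetricSpace X] [HadamardSpace X] (x y : X) :
    IsGeodesic x y (geodesicSegment x y) :=
  (HadamardSpace.exists_geodesic x y).choose_spec

/-! ### Alexandrov angles -/

/-- The angle at the vertex corresponding to `p` in a Euclidean comparison triangle for
`p`, `y`, `z` (where `y ≠ p ≠ z`), by the law of cosines. -/
noncomputable def comparisonAngle {X : Type*} [MetricSpace X] (p y z : X) : ℝ :=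
  Real.arccos ((dist p y ^ 2 + dist p z ^ 2 - dist y z ^ 2) / (2 * dist p y * dist p z))

/-- The Alexandrov angle between two geodesics `c`, `c'` issuing from `p`: the upper limit of the
comparison angles at `p` of `p`, `c s`, `c' t` as `s` and `t` decrease to `0` independently. -/
noncomputable def alexandrovAngle {X : Type*} [MetricSpace X] (p : X) (c c' : ℝ → X) : ℝ :=
  limsup (fun st : ℝ × ℝ => comparisonAngle p (c st.1) (c' st.2)) (𝓝[>] (0 : ℝ) ×ˢ 𝓝[>] (0 : ℝ))

/-- The angle `∠ a x y` between the geodesic segments `[x,a]` and `[x,y]`, for `a ≠ x ≠ y`. -/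
noncomputable def hadamardAngle {X : Type*} [MetricSpace X] [HadamardSpace X] (a x y : X) : ℝ :=
  alexandrovAngle x (geodesicSegment x a) (geodesicSegment x y)

/-! ### The mean deficit -/

/-- The mean deficit `(sup_{y ≠ x} min_{a ∈ A} d(a,x) cos ∠ a x y)⁺` of a nonempty finite set `A`
at a point `x ∉ A`. -/
noncomputable def meanDeficit {X : Type*} [MetricSpace X] [HadamardSpace X]
    (A : Finset X) (hA : A.Nonempty) (x : X) : ℝ :=
  max (⨆ y : {y : X // y ≠ x},
    A.inf' hA (fun a => dist a x * Real.cos (hadamardAngle a x y))) 0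

/-! ### Geodesics issuing from a point, with the angle as a pseudometric -/

/-- A nontrivial geodesic `[0, len] → X` issuing from `x`. -/
structure GeodesicFrom {X : Type*} [MetricSpace X] (x : X) where
  toFun : ℝ → X
  len : ℝ
  len_pos : 0 < len
  start : toFun 0 = x
  dist_eq : ∀ s ∈ Set.Icc 0 len, ∀ t ∈ Set.Icc 0 len, dist (toFun s) (toFun t) = |s - t|

theorem comparisonAngle_nonneg {X : Type*} [MetricSpace X] (p y z : X) :
    0 ≤ comparisonAngle p y z := Real.arccos_nonneg _

theorem comparisonAngle_le_pi {X : Type*} [MetricSpace X] (p y z : X) :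
    comparisonAngle p y z ≤ Real.pi := Real.arccos_le_pi _

theorem comparisonAngle_comm {X : Type*} [MetricSpace X] (p y z : X) :
    comparisonAngle p y z = comparisonAngle p z y := by
  unfold comparisonAngle
  rw [dist_comm y z, add_comm (dist p y ^ 2), mul_right_comm]

theorem comparisonAngle_isBounded {X : Type*} [MetricSpace X] (p : X) (c c' : ℝ → X)
    (F : Filter (ℝ × ℝ)) :
    IsBoundedUnder (· ≤ ·) F (fun st : ℝ × ℝ => comparisonAngle p (c st.1) (c' st.2)) :=
  isBoundedUnder_of ⟨Real.pi, fun _ => comparisonAngle_le_pi _ _ _⟩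

theorem comparisonAngle_isCobounded {X : Type*} [MetricSpace X] (p : X) (c c' : ℝ → X)
    (F : Filter (ℝ × ℝ)) [F.NeBot] :
    IsCoboundedUnder (· ≤ ·) F (fun st : ℝ × ℝ => comparisonAngle p (c st.1) (c' st.2)) :=
  IsBoundedUnder.isCoboundedUnder_le
    (isBoundedUnder_of ⟨0, fun _ => comparisonAngle_nonneg _ _ _⟩)

theorem alexandrovAngle_nonneg {X : Type*} [MetricSpace X] (p : X) (c c' : ℝ → X) :
    0 ≤ alexandrovAngle p c c' :=
  le_limsup_of_frequently_le
    (Eventually.of_forall fun _ => comparisonAngle_nonneg _ _ _).frequently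
    (comparisonAngle_isBounded p c c' _)

theorem alexandrovAngle_le_pi {X : Type*} [MetricSpace X] (p : X) (c c' : ℝ → X) :
    alexandrovAngle p c c' ≤ Real.pi :=
  limsup_le_of_le (comparisonAngle_isCobounded p c c' _)
    (Eventually.of_forall fun _ => comparisonAngle_le_pi _ _ _)

theorem alexandrovAngle_comm {X : Type*} [MetricSpace X] (p : X) (c c' : ℝ → X) :
    alexandrovAngle p c c' = alexandrovAngle p c' c := by
  unfold alexandrovAngle limsup
  conv_lhs => rw [Filter.prod_comm, Filter.map_map]
  congr 2
  funext st
  exact comparisonAngle_comm _ _ _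

/-- The law of cosines in the plane, with one of the sides on the real axis. -/
theorem norm_polar_sub_sq (s t θ : ℝ) :
    ‖(s : ℂ) * Complex.exp (θ * Complex.I) - t‖ ^ 2 = s ^ 2 + t ^ 2 - 2 * s * t * Real.cos θ := by
  rw [← Complex.normSq_eq_norm_sq, Complex.normSq_apply]
  simp only [Complex.sub_re, Complex.sub_im, Complex.mul_re, Complex.mul_im, Complex.ofReal_re,
    Complex.ofReal_im, Complex.exp_ofReal_mul_I_re, Complex.exp_ofReal_mul_I_im]
  nlinarith [Real.sin_sq_add_cos_sq θ]

/-- The law of cosines in the plane, for two vectors on opposite sides of the real axis. -/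
theorem norm_polar_sub_polar_sq (s u a b : ℝ) :
    ‖(s : ℂ) * Complex.exp (a * Complex.I) - u * Complex.exp ((-b : ℝ) * Complex.I)‖ ^ 2 =
      s ^ 2 + u ^ 2 - 2 * s * u * Real.cos (a + b) := by
  rw [← Complex.normSq_eq_norm_sq, Complex.normSq_apply]
  simp only [Complex.sub_re, Complex.sub_im, Complex.mul_re, Complex.mul_im, Complex.ofReal_re,
    Complex.ofReal_im, Complex.exp_ofReal_mul_I_re, Complex.exp_ofReal_mul_I_im, Real.cos_neg,
    Real.sin_neg, Real.cos_add]
  have h1 := Real.sin_sq_add_cos_sq a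
  have h2 := Real.sin_sq_add_cos_sq b
  linear_combination s ^ 2 * h1 + u ^ 2 * h2

theorem dist_sq_lt_of_comparisonAngle_lt {X : Type*} [MetricSpace X] {p y z : X} {θ : ℝ}
    (hy : 0 < dist p y) (hz : 0 < dist p z) (h0 : 0 ≤ θ) (hθ : θ ≤ Real.pi)
    (h : comparisonAngle p y z < θ) :
    dist y z ^ 2 < dist p y ^ 2 + dist p z ^ 2 - 2 * dist p y * dist p z * Real.cos θ := by
  by_contra! hc
  refine absurd h (not_lt.2 ?_)
  rw [← Real.arccos_cos h0 hθ]
  refine Real.arccos_le_arccos ?_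
  rw [div_le_iff₀ (by positivity)]
  linarith

theorem lt_dist_sq_of_lt_comparisonAngle {X : Type*} [MetricSpace X] {p y z : X} {θ : ℝ}
    (hy : 0 < dist p y) (hz : 0 < dist p z) (h0 : 0 ≤ θ) (hθ : θ ≤ Real.pi)
    (h : θ < comparisonAngle p y z) :
    dist p y ^ 2 + dist p z ^ 2 - 2 * dist p y * dist p z * Real.cos θ < dist y z ^ 2 := by
  by_contra! hc
  refine absurd h (not_lt.2 ?_)
  rw [← Real.arccos_cos h0 hθ]
  refine Real.arccos_le_arccos ?_
  rw [le_div_iff₀ (by positivity)]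
  linarith

namespace GeodesicFrom

theorem dist_start {X : Type*} [MetricSpace X] {x : X} (c : GeodesicFrom x) {s : ℝ}
    (hs : s ∈ Set.Ioo 0 c.len) : dist x (c.toFun s) = s := by
  have h := c.dist_eq 0 ⟨le_rfl, c.len_pos.le⟩ s ⟨hs.1.le, hs.2.le⟩
  rw [c.start] at h
  rw [h, zero_sub, abs_neg, abs_of_pos hs.1]

theorem alexandrovAngle_self {X : Type*} [MetricSpace X] {x : X} (c : GeodesicFrom x) :
    alexandrovAngle x c.toFun c.toFun = 0 := by
  have hev : ∀ᶠ s in 𝓝[>] (0 : ℝ), s ∈ Set.Ioo 0 c.len := Ioo_mem_nhdsGT c.len_pos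
  have : (fun st : ℝ × ℝ => comparisonAngle x (c.toFun st.1) (c.toFun st.2))
      =ᶠ[𝓝[>] (0 : ℝ) ×ˢ 𝓝[>] (0 : ℝ)] fun _ => (0 : ℝ) := by
    filter_upwards [hev.prod_mk hev] with st hst
    obtain ⟨h1, h2⟩ := hst
    unfold comparisonAngle
    rw [c.dist_start h1, c.dist_start h2,
      c.dist_eq _ ⟨h1.1.le, h1.2.le⟩ _ ⟨h2.1.le, h2.2.le⟩, sq_abs,
      show st.1 ^ 2 + st.2 ^ 2 - (st.1 - st.2) ^ 2 = 2 * st.1 * st.2 by ring,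
      div_self (by have := h1.1; have := h2.1; positivity), Real.arccos_one]
  unfold alexandrovAngle
  rw [limsup_congr this, limsup_const]

theorem alexandrovAngle_triangle {X : Type*} [MetricSpace X] {x : X} (c₁ c₂ c₃ : GeodesicFrom x) :
    alexandrovAngle x c₁.toFun c₃.toFun ≤
      alexandrovAngle x c₁.toFun c₂.toFun + alexandrovAngle x c₂.toFun c₃.toFun := by
  by_contra! hlt
  set α := alexandrovAngle x c₁.toFun c₂.toFun with hα
  set β := alexandrovAngle x c₂.toFun c₃.toFun with hβ
  set γ := alexandrovAngle x c₁.toFun c₃.toFun with hγ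
  have hα0 : 0 ≤ α := alexandrovAngle_nonneg _ _ _
  have hβ0 : 0 ≤ β := alexandrovAngle_nonneg _ _ _
  have hγπ : γ ≤ Real.pi := alexandrovAngle_le_pi _ _ _
  obtain ⟨δ, hδ, hδ'⟩ : ∃ δ : ℝ, 0 < δ ∧ α + δ + (β + δ) < γ :=
    ⟨(γ - α - β) / 3, by linarith, by linarith⟩
  set a := α + δ with ha
  set b := β + δ with hb
  have ha0 : 0 < a := by linarith
  have hb0 : 0 < b := by linarith
  have h12 : ∀ᶠ st in 𝓝[>] (0 : ℝ) ×ˢ 𝓝[>] (0 : ℝ),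
      comparisonAngle x (c₁.toFun st.1) (c₂.toFun st.2) < a :=
    eventually_lt_of_limsup_lt (show α < a by linarith) (comparisonAngle_isBounded _ _ _ _)
  have h23 : ∀ᶠ st in 𝓝[>] (0 : ℝ) ×ˢ 𝓝[>] (0 : ℝ),
      comparisonAngle x (c₂.toFun st.1) (c₃.toFun st.2) < b :=
    eventually_lt_of_limsup_lt (show β < b by linarith) (comparisonAngle_isBounded _ _ _ _)
  have h13 : ∃ᶠ st in 𝓝[>] (0 : ℝ) ×ˢ 𝓝[>] (0 : ℝ),
      a + b < comparisonAngle x (c₁.toFun st.1) (c₃.toFun st.2) :=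
    frequently_lt_of_lt_limsup (comparisonAngle_isCobounded _ _ _ _) hδ'
  have hbasis := (nhdsGT_basis (0 : ℝ)).prod_self
  obtain ⟨ε₁, hε₁, H12⟩ := hbasis.eventually_iff.1 h12
  obtain ⟨ε₂, hε₂, H23⟩ := hbasis.eventually_iff.1 h23
  obtain ⟨ε, hε0, hεle⟩ : ∃ ε : ℝ, 0 < ε ∧
      (ε ≤ ε₁ ∧ ε ≤ ε₂ ∧ ε ≤ c₁.len ∧ ε ≤ c₂.len ∧ ε ≤ c₃.len) :=
    ⟨min ε₁ (min ε₂ (min c₁.len (min c₂.len c₃.len))),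
      by simp [hε₁, hε₂, c₁.len_pos, c₂.len_pos, c₃.len_pos], by simp⟩
  obtain ⟨e1, e2, l1, l2, l3⟩ := hεle
  have hev : ∀ᶠ s in 𝓝[>] (0 : ℝ), s ∈ Set.Ioo 0 ε := Ioo_mem_nhdsGT hε0
  obtain ⟨⟨s, u⟩, hsu, hs, hu⟩ := (h13.and_eventually (hev.prod_mk hev)).exists
  simp only at hsu hs hu
  have hs0 := hs.1
  have hu0 := hu.1
  have hab : a + b < Real.pi := by linarith
  have hsa : 0 < Real.sin a := Real.sin_pos_of_pos_of_lt_pi ha0 (by linarith)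
  have hsb : 0 < Real.sin b := Real.sin_pos_of_pos_of_lt_pi hb0 (by linarith)
  have hsab : 0 < Real.sin (a + b) := Real.sin_pos_of_pos_of_lt_pi (by linarith) hab
  set D := s * Real.sin a + u * Real.sin b with hD
  have hD0 : 0 < D := by positivity
  set l := u * Real.sin b / D with hl
  have hl0 : 0 ≤ l := by positivity
  have hl1 : 1 - l = s * Real.sin a / D := by rw [hl, hD]; field_simp; ring
  have hl1' : 0 ≤ 1 - l := by rw [hl1]; positivity
  set t := s * u * Real.sin (a + b) / D with ht
  have ht0 : 0 < t := by positivity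
  set P : ℂ := (s : ℂ) * Complex.exp (a * Complex.I) with hP
  set Q : ℂ := (u : ℂ) * Complex.exp ((-b : ℝ) * Complex.I) with hQ
  have hPn : ‖P‖ = s := by
    rw [hP, norm_mul, Complex.norm_exp_ofReal_mul_I, mul_one, Complex.norm_real,
      Real.norm_of_nonneg hs0.le]
  have hQn : ‖Q‖ = u := by
    rw [hQ, norm_mul, Complex.norm_exp_ofReal_mul_I, mul_one, Complex.norm_real,
      Real.norm_of_nonneg hu0.le]
  have htPQ : (t : ℂ) = (l : ℂ) * P + ((1 - l : ℝ) : ℂ) * Q := by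
    rw [hl1]
    apply Complex.ext
    · simp only [hP, hQ, Complex.add_re, Complex.mul_re, Complex.mul_im, Complex.ofReal_re,
        Complex.ofReal_im, Complex.exp_ofReal_mul_I_re, Complex.exp_ofReal_mul_I_im, Real.cos_neg,
        Real.sin_neg]
      rw [ht, hl, Real.sin_add]
      field_simp
      ring
    · simp only [hP, hQ, Complex.add_im, Complex.mul_re, Complex.mul_im, Complex.ofReal_re,
        Complex.ofReal_im, Complex.exp_ofReal_mul_I_re, Complex.exp_ofReal_mul_I_im, Real.cos_neg,
        Real.sin_neg]
      rw [hl]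
      field_simp
      ring
  have htε : t < ε := by
    have h1 : t = ‖(t : ℂ)‖ := by rw [Complex.norm_real, Real.norm_of_nonneg ht0.le]
    have h2 : ‖(l : ℂ) * P + ((1 - l : ℝ) : ℂ) * Q‖ ≤ l * s + (1 - l) * u := by
      refine (norm_add_le _ _).trans ?_
      rw [norm_mul (l : ℂ) P, norm_mul _ Q, hPn, hQn, Complex.norm_real, Complex.norm_real,
        Real.norm_of_nonneg hl0, Real.norm_of_nonneg hl1']
    rw [h1, htPQ]
    refine h2.trans_lt ?_
    have := hs.2
    have := hu.2
    rcases hl0.eq_or_lt with h | h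
    · rw [← h]; linarith
    · nlinarith
  have dP : ‖P - t‖ + ‖(t : ℂ) - Q‖ = ‖P - Q‖ := by
    have e1 : P - t = ((1 - l : ℝ) : ℂ) * (P - Q) := by rw [htPQ]; push_cast; ring
    have e2 : (t : ℂ) - Q = (l : ℂ) * (P - Q) := by rw [htPQ]; push_cast; ring
    rw [e1, e2, norm_mul, norm_mul, Complex.norm_real, Complex.norm_real,
      Real.norm_of_nonneg hl0, Real.norm_of_nonneg hl1']
    ring
  have ds : dist x (c₁.toFun s) = s := c₁.dist_start ⟨hs0, hs.2.trans_le l1⟩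
  have dt : dist x (c₂.toFun t) = t := c₂.dist_start ⟨ht0, htε.trans_le l2⟩
  have du : dist x (c₃.toFun u) = u := c₃.dist_start ⟨hu0, hu.2.trans_le l3⟩
  have k12 : comparisonAngle x (c₁.toFun s) (c₂.toFun t) < a :=
    @H12 (s, t) ⟨⟨hs0, hs.2.trans_le e1⟩, ⟨ht0, htε.trans_le e1⟩⟩
  have k23 : comparisonAngle x (c₂.toFun t) (c₃.toFun u) < b :=
    @H23 (t, u) ⟨⟨ht0, htε.trans_le e2⟩, ⟨hu0, hu.2.trans_le e2⟩⟩
  have m12 := dist_sq_lt_of_comparisonAngle_lt (by rw [ds]; exact hs0) (by rw [dt]; exact ht0)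
    ha0.le (by linarith) k12
  have m23 := dist_sq_lt_of_comparisonAngle_lt (by rw [dt]; exact ht0) (by rw [du]; exact hu0)
    hb0.le (by linarith) k23
  have m13 := lt_dist_sq_of_lt_comparisonAngle (by rw [ds]; exact hs0) (by rw [du]; exact hu0)
    (by linarith) hab.le hsu
  rw [ds, dt, ← norm_polar_sub_sq s t a] at m12
  have nQ : ‖(t : ℂ) - Q‖ ^ 2 = t ^ 2 + u ^ 2 - 2 * t * u * Real.cos b := by
    rw [norm_sub_rev, hQ, norm_polar_sub_sq u t (-b), Real.cos_neg]
    ring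
  rw [dt, du, ← nQ] at m23
  rw [ds, du, ← norm_polar_sub_polar_sq s u a b] at m13
  have m12' := lt_of_pow_lt_pow_left₀ 2 (norm_nonneg _) m12
  have m23' := lt_of_pow_lt_pow_left₀ 2 (norm_nonneg _) m23
  have m13' := lt_of_pow_lt_pow_left₀ 2 dist_nonneg m13
  have := dist_triangle (c₁.toFun s) (c₂.toFun t) (c₃.toFun u)
  linarith

/-- The Alexandrov angle is a pseudometric on the set of nontrivial geodesics issuing from `x`. -/
noncomputable instance {X : Type*} [MetricSpace X] {x : X} :
    PseudoMetricSpace (GeodesicFrom x) where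
  dist c c' := alexandrovAngle x c.toFun c'.toFun
  dist_self c := c.alexandrovAngle_self
  dist_comm c c' := alexandrovAngle_comm _ _ _
  dist_triangle := alexandrovAngle_triangle

/-- The geodesic `[x,a]`, for `a ≠ x`. -/
noncomputable def toPoint {X : Type*} [MetricSpace X] [HadamardSpace X] (x a : X) (h : a ≠ x) :
    GeodesicFrom x where
  toFun := geodesicSegment x a
  len := dist x a
  len_pos := dist_pos.2 h.symm
  start := (geodesicSegment_isGeodesic x a).left
  dist_eq := (geodesicSegment_isGeodesic x a).dist_eq

end GeodesicFrom

/-! ### The tangent cone -/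

/-- The space of directions at `x`: nontrivial geodesics issuing from `x`, where geodesics making
an angle zero are identified, with the angle as metric. -/
abbrev SpaceOfDirections {X : Type*} [MetricSpace X] (x : X) : Type _ :=
  SeparationQuotient (GeodesicFrom x)

/-- A pair `([γ], r)` of a direction at `x` and a scalar `r ≥ 0`. -/
structure DirectedScalar {X : Type*} [MetricSpace X] (x : X) where
  direction : SpaceOfDirections x
  radius : ℝ
  radius_nonneg : 0 ≤ radius

theorem SpaceOfDirections.dist_le_pi {X : Type*} [MetricSpace X] {x : X}
    (u v : SpaceOfDirections x) : dist u v ≤ Real.pi := by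
  obtain ⟨u, rfl⟩ := SeparationQuotient.surjective_mk u
  obtain ⟨v, rfl⟩ := SeparationQuotient.surjective_mk v
  exact alexandrovAngle_le_pi _ _ _

/-- The triangle inequality in a Euclidean cone. -/
theorem sqrt_cone_triangle {r₁ r₂ r₃ a b c : ℝ} (h₁ : 0 ≤ r₁) (h₂ : 0 ≤ r₂) (h₃ : 0 ≤ r₃)
    (hb : 0 ≤ b) (hc : 0 ≤ c) (ha' : a ≤ Real.pi) (hb' : b ≤ Real.pi)
    (hc' : c ≤ Real.pi) (h : c ≤ a + b) :
    √(r₁ ^ 2 + r₃ ^ 2 - 2 * r₁ * r₃ * Real.cos c) ≤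
      √(r₁ ^ 2 + r₂ ^ 2 - 2 * r₁ * r₂ * Real.cos a) +
        √(r₂ ^ 2 + r₃ ^ 2 - 2 * r₂ * r₃ * Real.cos b) := by
  obtain ⟨b', hb0, hbb, hcab, hab⟩ : ∃ b', 0 ≤ b' ∧ b' ≤ b ∧ c ≤ a + b' ∧ a + b' ≤ Real.pi := by
    rcases le_total (a + b) Real.pi with h' | h'
    · exact ⟨b, hb, le_rfl, h, h'⟩
    · exact ⟨Real.pi - a, by linarith, by linarith, by linarith, by linarith⟩
  have hcos : Real.cos (a + b') ≤ Real.cos c := Real.cos_le_cos_of_nonneg_of_le_pi hc hab hcab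
  have hcosb : Real.cos b ≤ Real.cos b' := Real.cos_le_cos_of_nonneg_of_le_pi hb0 hb' hbb
  have h13 : 0 ≤ r₁ * r₃ := mul_nonneg h₁ h₃
  have h23 : 0 ≤ r₂ * r₃ := mul_nonneg h₂ h₃
  calc √(r₁ ^ 2 + r₃ ^ 2 - 2 * r₁ * r₃ * Real.cos c)
      ≤ √(r₁ ^ 2 + r₃ ^ 2 - 2 * r₁ * r₃ * Real.cos (a + b')) :=
        Real.sqrt_le_sqrt (by nlinarith)
    _ ≤ √(r₁ ^ 2 + r₂ ^ 2 - 2 * r₁ * r₂ * Real.cos a) +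
        √(r₂ ^ 2 + r₃ ^ 2 - 2 * r₂ * r₃ * Real.cos b') := by
        have e : r₂ ^ 2 + r₃ ^ 2 - 2 * r₂ * r₃ * Real.cos b' =
            r₃ ^ 2 + r₂ ^ 2 - 2 * r₃ * r₂ * Real.cos (-b') := by rw [Real.cos_neg]; ring
        rw [e, ← norm_polar_sub_polar_sq, ← norm_polar_sub_sq, ← norm_polar_sub_sq,
          Real.sqrt_sq (norm_nonneg _), Real.sqrt_sq (norm_nonneg _), Real.sqrt_sq (norm_nonneg _),
          norm_sub_rev ((r₃ : ℂ) * _) (r₂ : ℂ)]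
        exact norm_sub_le_norm_sub_add_norm_sub _ _ _
    _ ≤ √(r₁ ^ 2 + r₂ ^ 2 - 2 * r₁ * r₂ * Real.cos a) +
        √(r₂ ^ 2 + r₃ ^ 2 - 2 * r₂ * r₃ * Real.cos b) := by
        gcongr _ + √?_
        nlinarith

/-- The Euclidean cone distance
`d(([γ],r),([γ'],r'))² = r² + r'² - 2 r r' cos ∠(γ,γ')`. -/
noncomputable instance {X : Type*} [MetricSpace X] {x : X} :
    PseudoMetricSpace (DirectedScalar x) where
  dist v w := √(v.radius ^ 2 + w.radius ^ 2 -
    2 * v.radius * w.radius * Real.cos (dist v.direction w.direction))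
  dist_self v := by
    rw [dist_self, Real.cos_zero]
    ring_nf
    exact Real.sqrt_zero
  dist_comm v w := by
    rw [dist_comm v.direction]
    ring_nf
  dist_triangle u v w :=
    sqrt_cone_triangle u.radius_nonneg v.radius_nonneg w.radius_nonneg dist_nonneg
      dist_nonneg (SpaceOfDirections.dist_le_pi _ _) (SpaceOfDirections.dist_le_pi _ _)
      (SpaceOfDirections.dist_le_pi _ _) (dist_triangle _ _ _)

theorem DirectedScalar.dist_def {X : Type*} [MetricSpace X] {x : X} (v w : DirectedScalar x) :
    dist v w = √(v.radius ^ 2 + w.radius ^ 2 -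
      2 * v.radius * w.radius * Real.cos (dist v.direction w.direction)) := rfl

/-- The tangent cone `T_x X`: the Euclidean cone over the space of directions.  Its elements are
the pairs `([γ], r)` with `r ≥ 0`, where the pairs `([γ], 0)` are all identified (as are any pairs
at distance zero). -/
abbrev TangentCone {X : Type*} [MetricSpace X] (x : X) : Type _ :=
  SeparationQuotient (DirectedScalar x)

namespace TangentCone

/-- The length `r` of an element `([γ], r)` of the tangent cone. -/
noncomputable def length {X : Type*} [MetricSpace X] {x : X} : TangentCone x → ℝ :=
  SeparationQuotient.lift DirectedScalar.radius fun v w h => by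
    have h0 : dist v w = 0 := Metric.inseparable_iff.1 h
    rw [DirectedScalar.dist_def, Real.sqrt_eq_zero'] at h0
    have h1 := Real.cos_le_one (dist v.direction w.direction)
    have h2 := mul_nonneg v.radius_nonneg w.radius_nonneg
    have h3 : (v.radius - w.radius) ^ 2 ≤ 0 := by nlinarith
    exact sub_eq_zero.1 (pow_eq_zero_iff two_ne_zero |>.1 (le_antisymm h3 (sq_nonneg _)))

/-- The tangent vector `([[x,a]], d(x,a))` at `x` pointing to `a ≠ x`. -/
noncomputable def toPoint {X : Type*} [MetricSpace X] [HadamardSpace X] (x a : X) (h : a ≠ x) :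
    TangentCone x :=
  SeparationQuotient.mk
    { direction := SeparationQuotient.mk (GeodesicFrom.toPoint x a h)
      radius := dist x a
      radius_nonneg := dist_nonneg }

/-- The set of convex combinations in `T_x X` of the vectors `([[x,a]], d(x,a))` for `a ∈ A`, when
`T_x X` is identified with a Euclidean space `E` through an isometry `φ`.  The set does not depend
on `φ`, which need not map the apex to `0`, since isometries between Euclidean spaces are affine. -/
def convexCombinations {X : Type*} [MetricSpace X] [HadamardSpace X] {E : Type*}
    [NormedAddCommGroup E] [InnerProductSpace ℝ E] (A : Finset X) (x : X) (hx : x ∉ A)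
    (φ : TangentCone x ≃ᵢ E) : Set (TangentCone x) :=
  {v | φ v ∈ convexHull ℝ
    (Set.range fun a : {a // a ∈ A} => φ (toPoint x a (ne_of_mem_of_not_mem a.2 hx)))}

end TangentCone

/-! Take the image of the apex under `φ` as origin of `E`. The cone metric is the law of cosines, so
polarization turns `r * s * cos ∠` into an inner product (`TangentCone.inner_sub_apex`). Geodesics
being unique, every direction at `x` is that of a segment `[x,y]`
(`SpaceOfDirections.exists_toPoint`). The supremum in the deficit is therefore the supremum, over
the unit vectors `u` of `E`, of `min ⟨a, u⟩`, where `a` runs through the vectors of `A`. What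
remains is Euclidean duality. For a convex combination `v`, `min ⟨a, u⟩ ≤ ⟨v, u⟩ ≤ ‖v‖`
(`TangentCone.inf'_le_length`). The shortest `v` satisfies `⟨a, v⟩ ≥ ‖v‖²` for all `a`, so if `v ≠
0` the direction `u = v / ‖v‖` attains the bound; if `v = 0`, the truncation at `0` does. -/

/-- Geodesics in a Hadamard space are determined by their end points. -/
theorem IsGeodesic.eqOn {X : Type*} [MetricSpace X] [HadamardSpace X] {x y : X} {γ δ : ℝ → X}
    (hγ : IsGeodesic x y γ) (hδ : IsGeodesic x y δ) : Set.EqOn γ δ (Set.Icc 0 (dist x y)) := by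
  intro s hs
  rcases (dist_nonneg : 0 ≤ dist x y).eq_or_lt with h | hd
  · have hs0 : s = 0 := le_antisymm (hs.2.trans h.symm.le) hs.1
    rw [hs0, hγ.left, hδ.left]
  have ht : s / dist x y ∈ Set.Icc (0 : ℝ) 1 :=
    ⟨div_nonneg hs.1 hd.le, (div_le_one hd).2 hs.2⟩
  -- The `CAT(0)` inequality is applied to the point `δ s` and the geodesic `γ`, at the same
  -- parameter `s`; its right side then vanishes.
  have key := HadamardSpace.cat_zero x y γ hγ (δ s) _ ht
  have h0 := hδ.dist_eq s hs 0 ⟨le_rfl, hd.le⟩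
  have h1 := hδ.dist_eq s hs _ ⟨hd.le, le_rfl⟩
  rw [hδ.left] at h0
  rw [hδ.right] at h1
  rw [h0, h1, sq_abs, sq_abs, div_mul_cancel₀ _ hd.ne'] at key
  have hz : (1 - s / dist x y) * (s - 0) ^ 2 + s / dist x y * (s - dist x y) ^ 2 -
      s / dist x y * (1 - s / dist x y) * dist x y ^ 2 = 0 := by
    field_simp
    ring
  rw [hz] at key
  exact (dist_eq_zero.1 (pow_eq_zero_iff two_ne_zero |>.1 (le_antisymm key (sq_nonneg _)))).symm

/-! ### Directions as directions of segments -/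

namespace GeodesicFrom

theorem dist_start_end {X : Type*} [MetricSpace X] {x : X} (c : GeodesicFrom x) :
    dist x (c.toFun c.len) = c.len := by
  have h := c.dist_eq 0 ⟨le_rfl, c.len_pos.le⟩ c.len ⟨c.len_pos.le, le_rfl⟩
  rwa [c.start, zero_sub, abs_neg, abs_of_pos c.len_pos] at h

theorem isGeodesic {X : Type*} [MetricSpace X] {x : X} (c : GeodesicFrom x) :
    IsGeodesic x (c.toFun c.len) c.toFun where
  left := c.start
  right := by rw [c.dist_start_end]
  dist_eq := by rw [c.dist_start_end]; exact c.dist_eq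

theorem end_ne {X : Type*} [MetricSpace X] {x : X} (c : GeodesicFrom x) :
    c.toFun c.len ≠ x :=
  (dist_pos.1 (c.len_pos.trans_eq c.dist_start_end.symm)).symm

theorem dist_toPoint_end {X : Type*} [MetricSpace X] [HadamardSpace X] {x : X}
    (c : GeodesicFrom x) : dist c (toPoint x (c.toFun c.len) c.end_ne) = 0 := by
  -- The angle depends only on the germs at `0`, where `c` and the chosen segment to its end point
  -- agree.
  rw [← dist_self c]
  refine limsup_congr ?_
  have hev : ∀ᶠ s in 𝓝[>] (0 : ℝ), s ∈ Set.Ioo 0 c.len := Ioo_mem_nhdsGT c.len_pos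
  filter_upwards [hev.prod_mk hev] with st hst
  have h : geodesicSegment x (c.toFun c.len) st.2 = c.toFun st.2 :=
    (geodesicSegment_isGeodesic _ _).eqOn c.isGeodesic
      ⟨hst.2.1.le, by rw [c.dist_start_end]; exact hst.2.2.le⟩
  change comparisonAngle x (c.toFun st.1) (geodesicSegment x (c.toFun c.len) st.2) = _
  rw [h]

end GeodesicFrom

/-- In a Hadamard space every direction at `x` is the direction of a segment `[x,y]`. -/
theorem SpaceOfDirections.exists_toPoint {X : Type*} [MetricSpace X] [HadamardSpace X] {x : X}
    (u : SpaceOfDirections x) :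
    ∃ (y : X) (hy : y ≠ x), u = SeparationQuotient.mk (GeodesicFrom.toPoint x y hy) := by
  obtain ⟨c, rfl⟩ := SeparationQuotient.surjective_mk u
  exact ⟨_, c.end_ne, SeparationQuotient.mk_eq_mk.2 (Metric.inseparable_iff.2 c.dist_toPoint_end)⟩

/-! ### Lengths and inner products in the tangent cone -/

namespace TangentCone

variable {X : Type*} [MetricSpace X] [HadamardSpace X] {x : X}

/-- The vector of length `r ≥ 0` in the direction of `[x,y]`. -/
noncomputable def vec (y : X) (hy : y ≠ x) (r : ℝ) (hr : 0 ≤ r) : TangentCone x :=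
  SeparationQuotient.mk ⟨SeparationQuotient.mk (GeodesicFrom.toPoint x y hy), r, hr⟩

theorem exists_vec (v : TangentCone x) :
    ∃ (y : X) (hy : y ≠ x) (r : ℝ) (hr : 0 ≤ r), v = vec y hy r hr := by
  obtain ⟨⟨u, r, hr⟩, rfl⟩ := SeparationQuotient.surjective_mk v
  obtain ⟨y, hy, rfl⟩ := SpaceOfDirections.exists_toPoint u
  exact ⟨y, hy, r, hr, rfl⟩

theorem length_vec (y : X) (hy : y ≠ x) (r : ℝ) (hr : 0 ≤ r) : length (vec y hy r hr) = r := rfl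

theorem toPoint_eq_vec (a : X) (ha : a ≠ x) : toPoint x a ha = vec a ha (dist x a) dist_nonneg :=
  rfl

theorem dist_vec_sq (y z : X) (hy : y ≠ x) (hz : z ≠ x) (r s : ℝ) (hr : 0 ≤ r) (hs : 0 ≤ s) :
    dist (vec y hy r hr) (vec z hz s hs) ^ 2 =
      r ^ 2 + s ^ 2 - 2 * r * s * Real.cos (hadamardAngle y x z) := by
  change √(r ^ 2 + s ^ 2 - 2 * r * s * Real.cos (hadamardAngle y x z)) ^ 2 = _
  refine Real.sq_sqrt ?_
  -- The radicand is at least `(r - s) ^ 2`.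
  nlinarith [Real.cos_le_one (hadamardAngle y x z), mul_nonneg hr hs, sq_nonneg (r - s)]

/-- A vector of radius `0` is the apex whatever its direction `y`. Length thus becomes a distance,
which isometries preserve. -/
theorem dist_vec_zero (v : TangentCone x) (y : X) (hy : y ≠ x) :
    dist v (vec y hy 0 le_rfl) = length v := by
  obtain ⟨z, hz, r, hr, rfl⟩ := exists_vec v
  rw [length_vec, ← sq_eq_sq₀ dist_nonneg hr, dist_vec_sq]
  ring

variable {E : Type*} [NormedAddCommGroup E] [InnerProductSpace ℝ E]

/-- An isometry onto a Euclidean space turns the angle at `x` into the angle at the image of the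
apex. -/
theorem inner_sub_apex (φ : TangentCone x ≃ᵢ E) (y₀ y z : X) (hy₀ : y₀ ≠ x) (hy : y ≠ x)
    (hz : z ≠ x) (r s : ℝ) (hr : 0 ≤ r) (hs : 0 ≤ s) :
    inner ℝ (φ (vec y hy r hr) - φ (vec y₀ hy₀ 0 le_rfl))
      (φ (vec z hz s hs) - φ (vec y₀ hy₀ 0 le_rfl)) = r * s * Real.cos (hadamardAngle y x z) := by
  rw [real_inner_eq_norm_mul_self_add_norm_mul_self_sub_norm_sub_mul_self_div_two,
    sub_sub_sub_cancel_right, ← dist_eq_norm, ← dist_eq_norm, ← dist_eq_norm, φ.dist_eq,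
    φ.dist_eq, φ.dist_eq, dist_vec_zero, dist_vec_zero, length_vec, length_vec, ← sq (dist _ _),
    dist_vec_sq]
  ring

/-- With a unit vector towards `y`, the terms of the deficit become values of one linear functional
on the vectors of `A`. -/
theorem dist_mul_cos_eq_inner (φ : TangentCone x ≃ᵢ E) (y₀ a y : X) (hy₀ : y₀ ≠ x) (ha : a ≠ x)
    (hy : y ≠ x) :
    dist a x * Real.cos (hadamardAngle a x y) =
      inner ℝ (φ (toPoint x a ha) - φ (vec y₀ hy₀ 0 le_rfl))
        (φ (vec y hy 1 zero_le_one) - φ (vec y₀ hy₀ 0 le_rfl)) := by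
  rw [toPoint_eq_vec, inner_sub_apex, dist_comm, mul_one]

/-! ### Duality between the deficit and the shortest convex combination -/

/-- A half-space containing the vectors of `A` contains their hull; Cauchy–Schwarz with a unit
normal does the rest. -/
theorem inf'_le_length (A : Finset X) (hA : A.Nonempty) (hx : x ∉ A) (φ : TangentCone x ≃ᵢ E)
    (y : X) (hy : y ≠ x) {v : TangentCone x} (hv : v ∈ convexCombinations A x hx φ) :
    A.inf' hA (fun a => dist a x * Real.cos (hadamardAngle a x y)) ≤ length v := by
  set m := A.inf' hA (fun a => dist a x * Real.cos (hadamardAngle a x y))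
  set c := φ (vec y hy 0 le_rfl) with hc
  set u := φ (vec y hy 1 zero_le_one) - c with hu
  have hu1 : ‖u‖ = 1 := by
    rw [hu, ← dist_eq_norm, φ.dist_eq, dist_vec_zero, length_vec]
  -- The shift by `inner ℝ u c` is there because the apex need not go to `0`.
  have hconv : Convex ℝ {w : E | m + inner ℝ u c ≤ inner ℝ u w} :=
    convex_halfSpace_ge (innerₗ E u).isLinear _
  have hsub := convexHull_min (s := Set.range fun a : {a // a ∈ A} =>
      φ (toPoint x a (ne_of_mem_of_not_mem a.2 hx))) (by
    rintro _ ⟨a, rfl⟩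
    have h : m ≤ dist (a : X) x * Real.cos (hadamardAngle (a : X) x y) :=
      Finset.inf'_le (fun a => dist a x * Real.cos (hadamardAngle a x y)) a.2
    rw [dist_mul_cos_eq_inner φ y a y hy (ne_of_mem_of_not_mem a.2 hx) hy, real_inner_comm,
      inner_sub_right] at h
    change m + inner ℝ u c ≤ inner ℝ u _
    linarith) hconv hv
  have h1 : m ≤ inner ℝ u (φ v - c) := by
    have h : m + inner ℝ u c ≤ inner ℝ u (φ v) := hsub
    rw [inner_sub_right]
    linarith
  calc m ≤ ‖u‖ * ‖φ v - c‖ := h1.trans (real_inner_le_norm _ _)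
    _ = length v := by rw [hu1, one_mul, ← dist_eq_norm, φ.dist_eq, dist_vec_zero]

/-- A shortest convex combination `v` satisfies `⟨a, v⟩ ≥ ‖v‖²` for every `a ∈ A`. -/
theorem exists_convexCombination_sq_le_inner [FiniteDimensional ℝ E] (A : Finset X)
    (hA : A.Nonempty) (hx : x ∉ A) (φ : TangentCone x ≃ᵢ E) (y₀ : X) (hy₀ : y₀ ≠ x) :
    ∃ v ∈ convexCombinations A x hx φ, ∀ (a : X) (ha : a ∈ A), length v ^ 2 ≤
      inner ℝ (φ (toPoint x a (ne_of_mem_of_not_mem ha hx)) - φ (vec y₀ hy₀ 0 le_rfl))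
        (φ v - φ (vec y₀ hy₀ 0 le_rfl)) := by
  set c := φ (vec y₀ hy₀ 0 le_rfl) with hc
  set S := Set.range fun a : {a // a ∈ A} => φ (toPoint x a (ne_of_mem_of_not_mem a.2 hx)) with hS
  have : Nonempty {a // a ∈ A} := hA.to_subtype
  have hK : IsCompact (convexHull ℝ S) := (Set.finite_range _).isCompact_convexHull ℝ
  obtain ⟨p, hp, hmin⟩ := exists_norm_eq_iInf_of_complete_convex
    ((Set.range_nonempty _).convexHull : (convexHull ℝ S).Nonempty) hK.isComplete
    (convex_convexHull ℝ S) c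
  -- Variational inequality for the point `p` of the hull nearest to `c`: the angle at `p` between
  -- `c` and any point of the hull is not acute.
  rw [norm_eq_iInf_iff_real_inner_le_zero (convex_convexHull ℝ S) hp] at hmin
  refine ⟨φ.symm p, by simpa [convexCombinations] using hp, fun a ha => ?_⟩
  have h := hmin _ (subset_convexHull ℝ S ⟨⟨a, ha⟩, rfl⟩)
  rw [← dist_vec_zero _ y₀ hy₀, ← φ.dist_eq, φ.apply_symm_apply, dist_eq_norm, ← hc]
  set q := φ (toPoint x a (ne_of_mem_of_not_mem ha hx))
  have e : inner ℝ (q - c) (p - c) - ‖p - c‖ ^ 2 = - inner ℝ (c - p) (q - p) := by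
    rw [← real_inner_self_eq_norm_sq, ← inner_sub_left, sub_sub_sub_cancel_right,
      ← neg_sub p c, inner_neg_left, neg_neg, real_inner_comm]
  change inner ℝ (c - p) (q - p) ≤ 0 at h
  linarith

end TangentCone

theorem mainTheorem8 {X : Type*} [MetricSpace X] [HadamardSpace X]
    (A : Finset X) (hA : A.Nonempty) (x : X) (hx : x ∉ A)
    {E : Type*} [NormedAddCommGroup E] [InnerProductSpace ℝ E] [FiniteDimensional ℝ E]
    (φ : TangentCone x ≃ᵢ E) :
    IsLeast (TangentCone.length '' TangentCone.convexCombinations A x hx φ)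
      (meanDeficit A hA x) := by
  obtain ⟨y₀, hy₀A⟩ := hA
  have hy₀ : y₀ ≠ x := ne_of_mem_of_not_mem hy₀A hx
  have hne : Nonempty {y : X // y ≠ x} := ⟨⟨y₀, hy₀⟩⟩
  have hlen : ∀ v : TangentCone x, 0 ≤ v.length := fun v => by
    rw [← TangentCone.dist_vec_zero v y₀ hy₀]
    exact dist_nonneg
  have hlow : ∀ v ∈ TangentCone.convexCombinations A x hx φ,
      meanDeficit A ⟨y₀, hy₀A⟩ x ≤ v.length :=
    fun v hv => max_le
      (ciSup_le fun y => TangentCone.inf'_le_length A _ hx φ y y.2 hv) (hlen v)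
  refine ⟨?_, by rintro _ ⟨v, hv, rfl⟩; exact hlow v hv⟩
  obtain ⟨v, hv, hinner⟩ :=
    TangentCone.exists_convexCombination_sq_le_inner A ⟨y₀, hy₀A⟩ hx φ y₀ hy₀
  refine ⟨v, hv, le_antisymm ?_ (hlow v hv)⟩
  obtain ⟨y, hy, r, hr, rfl⟩ := TangentCone.exists_vec v
  -- If the shortest combination is the apex, it has no direction to test, and the truncation at `0`
  -- gives the bound.
  rcases hr.eq_or_lt with h0 | hr0
  · rw [TangentCone.length_vec, ← h0]
    exact le_max_right _ _
  -- An unbounded real supremum would default to `0`; the length of `v` is an upper bound.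
  have hbdd : BddAbove (Set.range fun y : {y : X // y ≠ x} =>
      A.inf' ⟨y₀, hy₀A⟩ (fun a => dist a x * Real.cos (hadamardAngle a x y))) :=
    ⟨_, by rintro _ ⟨z, rfl⟩; exact TangentCone.inf'_le_length A _ hx φ z z.2 hv⟩
  refine le_max_of_le_left (le_trans ?_ (le_ciSup hbdd ⟨y, hy⟩))
  refine Finset.le_inf' _ _ fun a ha => ?_
  have h := hinner a ha
  rw [TangentCone.toPoint_eq_vec, TangentCone.inner_sub_apex, TangentCone.length_vec,
    dist_comm] at h
  rw [TangentCone.length_vec]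
  -- Here `h` says `r ^ 2 ≤ d(a,x) * r * cos ∠`; one factor `r` cancels.
  refine le_of_mul_le_mul_left ?_ hr0
  linarith
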